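/- Theorem 5. Let $n_1,n_2,m_1,m_2\in\mathbb{N}$, let the class labels $(C_1,C_2)\in\{1,\dots,K_1\}\times\{1,\dots,K_2\}$ have joint pmf $p_{C_1,C_2}$, and suppose that, conditioned on $(C_1,C_2)=(i,k)$, the pair of signals $x=(x_1,x_2)\in\mathbb{R}^{n_1}\times\mathbb{R}^{n_2}$ is Gaussian $\mathcal N(\mu_x^{(ik)},\Sigma_x^{(ik)})$, where $\Sigma_x^{(ik)}$ is positive semidefinite (possibly singular) with diagonal blocks $\Sigma_{x_1}^{(ik)}$ and $\Sigma_{x_2}^{(ik)}$. Put $r_x^{(ik)}=\operatorname{rank}\Sigma_x^{(ik)}$, $r_{x_1}^{(ik)}=\operatorname{rank}\Sigma_{x_1}^{(ik)}$, $r_{x_2}^{(ik)}=\operatorname{rank}\Sigma_{x_2}^{(ik)}$. Let $y_1=\Phi_1x_1+w_1\in\mathbb{R}^{m_1}$ and $y_2=\Phi_2x_2+w_2\in\mathbb{R}^{m_2}$, where $w_1\sim\mathcal N(0,\sigma^2 I)$ and $w_2\sim\mathcal N(0,\sigma^2 I)$ are independent of each other and of $(C_1,C_2,x_1,x_2)$,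 and where $\Phi_1\in\mathbb{R}^{m_1\times n_1}$ and $\Phi_2\in\mathbb{R}^{m_2\times n_2}$ are random matrices, independent of labels, signals and noises, that are left rotation-invariant: the entries of the matrix have a joint pdf $p$ with $p(\Theta A)=p(A)$ for every orthogonal $\Theta$. The case that $m_2=n_2$ and $\Phi_2$ is the identity matrix is also allowed. For given $\Phi_1,\Phi_2$ let $$\mathrm{MMSE}(\sigma^2)=\mathbb{E}\bigl[\|x_1-\mathbb{E}[x_1\mid y_1,y_2]\|^2\bigr],$$ where the expectation is over labels, signals and noises. Then, with probability 1 with respect to $(\Phi_1,\Phi_2)$: if $\lim_{\sigma^2\to0}\mathrm{MMSE}(\sigma^2)=0$, then for every $(i,k)$ with $p_{C_1,C_2}(i,k)>0$, $$m_1\ge r_{x_1}^{(ik)}\qquad\text{or}\qquad\bigl(m_1\ge r_x^{(ik)}-r_{x_2}^{(ik)}\ \text{ and }\ m_1+m_2\ge r_x^{(ik)}\bigr).$$ -/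

import Mathlib

open MeasureTheory ProbabilityTheory Filter Topology
open scoped ENNReal

namespace GMMSideInfo

noncomputable section

/-- A joint Gaussian mixture model for a pair of signals `x₁ ∈ ℝ^{n₁}`, `x₂ ∈ ℝ^{n₂}` with latent
class labels `C₁ ∈ {1, …, K₁}`, `C₂ ∈ {1, …, K₂}`: the joint pmf of the labels and, for every pair
of classes, the mean and the (positive semidefinite, possibly singular) covariance matrix of the
stacked vector `x = (x₁, x₂)`. -/
structure JointGMM (K₁ K₂ n₁ n₂ : ℕ) where
  pmf : PMF (Fin K₁ × Fin K₂)
  mean : Fin K₁ → Fin K₂ → EuclideanSpace ℝ (Fin n₁ ⊕ Fin n₂)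
  cov : Fin K₁ → Fin K₂ → Matrix (Fin n₁ ⊕ Fin n₂) (Fin n₁ ⊕ Fin n₂) ℝ
  cov_posSemidef : ∀ i k, (cov i k).PosSemidef

namespace JointGMM

variable {K₁ K₂ n₁ n₂ : ℕ} (M : JointGMM K₁ K₂ n₁ n₂)

/-- `r_x^{(ik)}`, the rank of the covariance matrix of `x = (x₁, x₂)` in class `(i, k)`. -/
def rankX (i : Fin K₁) (k : Fin K₂) : ℕ := (M.cov i k).rank

/-- `r_{x₁}^{(ik)}`, the rank of the covariance matrix of `x₁` in class `(i, k)`. -/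
def rankX₁ (i : Fin K₁) (k : Fin K₂) : ℕ := (M.cov i k).toBlocks₁₁.rank

/-- `r_{x₂}^{(ik)}`, the rank of the covariance matrix of `x₂` in class `(i, k)`. -/
def rankX₂ (i : Fin K₁) (k : Fin K₂) : ℕ := (M.cov i k).toBlocks₂₂.rank

/-- The joint law of the labels and the signals: the labels follow the pmf and, given the labels
`(i, k)`, the stacked signal is Gaussian with mean `mean i k` and covariance `cov i k`. -/
def law : Measure ((Fin K₁ × Fin K₂) × EuclideanSpace ℝ (Fin n₁ ⊕ Fin n₂)) :=
  ∑ c : Fin K₁ × Fin K₂,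
    M.pmf c • (Measure.dirac c).prod (multivariateGaussian (M.mean c.1 c.2) (M.cov c.1 c.2))

end JointGMM

/-- The sample space of the sensing model: `((labels, (x₁, x₂)), (w₁, w₂))`. -/
abbrev Sample (K₁ K₂ n₁ n₂ m₁ m₂ : ℕ) : Type :=
  ((Fin K₁ × Fin K₂) × EuclideanSpace ℝ (Fin n₁ ⊕ Fin n₂)) ×
    (EuclideanSpace ℝ (Fin m₁) × EuclideanSpace ℝ (Fin m₂))

/-- The law `𝒩(0, v • I)` on `ℝ^m` of the additive noise with variance `v`. -/
def noiseLaw (m : ℕ) (v : ℝ) : Measure (EuclideanSpace ℝ (Fin m)) :=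
  multivariateGaussian 0 (v • (1 : Matrix (Fin m) (Fin m) ℝ))

variable {K₁ K₂ n₁ n₂ m₁ m₂ : ℕ}

/-- The law of labels, signals and noises at noise variance `v`; the labelled signal pair, `w₁`
and `w₂` are independent. -/
def modelLaw (M : JointGMM K₁ K₂ n₁ n₂) (m₁ m₂ : ℕ) (v : ℝ) :
    Measure (Sample K₁ K₂ n₁ n₂ m₁ m₂) :=
  M.law.prod ((noiseLaw m₁ v).prod (noiseLaw m₂ v))

/-- The signal of interest `x₁`. -/
def signal₁ (s : Sample K₁ K₂ n₁ n₂ m₁ m₂) : EuclideanSpace ℝ (Fin n₁) :=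
  WithLp.toLp 2 fun a => s.1.2 (Sum.inl a)

/-- The side information signal `x₂`. -/
def signal₂ (s : Sample K₁ K₂ n₁ n₂ m₁ m₂) : EuclideanSpace ℝ (Fin n₂) :=
  WithLp.toLp 2 fun b => s.1.2 (Sum.inr b)

/-- The pair of feature vectors `y₁ = Φ₁ x₁ + w₁` and `y₂ = Φ₂ x₂ + w₂`. -/
def features (Φ₁ : Matrix (Fin m₁) (Fin n₁) ℝ) (Φ₂ : Matrix (Fin m₂) (Fin n₂) ℝ)
    (s : Sample K₁ K₂ n₁ n₂ m₁ m₂) : EuclideanSpace ℝ (Fin m₁) × EuclideanSpace ℝ (Fin m₂) :=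
  (Matrix.toEuclideanLin Φ₁ (signal₁ s) + s.2.1, Matrix.toEuclideanLin Φ₂ (signal₂ s) + s.2.2)

/-- The mean squared error `E ‖u - E[u | y]‖²` of the conditional mean estimator of `u` from `y`,
as an extended nonnegative real. -/
def mmse {Ω E F : Type*} [MeasurableSpace Ω] [NormedAddCommGroup E] [NormedSpace ℝ E]
    [CompleteSpace E] [mF : MeasurableSpace F] (P : Measure Ω) (u : Ω → E) (y : Ω → F) : ℝ≥0∞ :=
  ∫⁻ ω, ‖u ω - (P[u | MeasurableSpace.comap y mF]) ω‖ₑ ^ 2 ∂P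

/-- The MMSE of `x₁` from `(y₁, y₂)` for given kernels `Φ₁`, `Φ₂`, as a function of the noise
variance `v`. -/
def mmseGMM (M : JointGMM K₁ K₂ n₁ n₂) (Φ₁ : Matrix (Fin m₁) (Fin n₁) ℝ)
    (Φ₂ : Matrix (Fin m₂) (Fin n₂) ℝ) (v : ℝ) : ℝ≥0∞ :=
  mmse (modelLaw M m₁ m₂ v) signal₁ (features Φ₁ Φ₂)

/-- A random `m × n` matrix is left rotation-invariant if its entries have a joint pdf `p` with
`p (Θ A) = p A` for every orthogonal matrix `Θ`. A pdf is determined up to null sets only, so the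
identity is asked for almost every `A`. -/
def IsLeftRotationInvariant {Ω : Type*} [MeasurableSpace Ω] (P : Measure Ω) {m n : ℕ}
    (Φ : Ω → Matrix (Fin m) (Fin n) ℝ) : Prop :=
  AEMeasurable (fun ω i j => Φ ω i j) P ∧
    ∃ p : (Fin m → Fin n → ℝ) → ℝ≥0∞, Measurable p ∧
      P.map (fun ω i j => Φ ω i j) = (volume : Measure (Fin m → Fin n → ℝ)).withDensity p ∧
      ∀ Θ ∈ Matrix.orthogonalGroup (Fin m) ℝ,
        ∀ᵐ A : Fin m → Fin n → ℝ, p (fun i j => (Θ * Matrix.of A) i j) = p A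

/-- The random `m × n` matrix `Φ` is square and almost surely the identity matrix. -/
def IsIdentityKernel {Ω : Type*} [MeasurableSpace Ω] (P : Measure Ω) {m n : ℕ}
    (Φ : Ω → Matrix (Fin m) (Fin n) ℝ) : Prop :=
  ∃ h : m = n, ∀ᵐ ω ∂P, Φ ω = (1 : Matrix (Fin n) (Fin n) ℝ).submatrix (Fin.cast h) id

end

end GMMSideInfo

/-! ### Reflections preserving a Gaussian law -/

namespace GMMSideInfo

/-! Suppose `z = S u` lies in the range of a class covariance `S`, is killed by both kernels, and
has first component `z₁ ≠ 0`. The `S`-oblique reflection along `z` preserves the class law and, with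
the noise held fixed, the features, but it moves `x₁` along `z₁`. An estimator depending only on the
features takes the same value at both points, so it errs at one of them by an amount independent of
the noise (`le_mmseGMM_of_feature_eq_zero`). Vanishing MMSE therefore forces every invisible vector
of range `S` to have zero first component. The rest is dimension counting
(`finrank_bounds_of_features`), using that almost surely `Φ₂` has maximal rank on the fixed subspace
of second components of vectors in range `S` with zero first component
(`ae_min_le_finrank_map_kernel`). -/

/-- The affine reflection `x ↦ x - (2 ⟪u, x - μ⟫ / q) z`. -/
noncomputable def affineReflection {ι : Type*} [Fintype ι] (μ u z : EuclideanSpace ℝ ι) (q : ℝ)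
    (x : EuclideanSpace ℝ ι) : EuclideanSpace ℝ ι :=
  x - (2 * inner ℝ u (x - μ) / q) • z

lemma continuous_affineReflection {ι : Type*} [Fintype ι] (μ u z : EuclideanSpace ℝ ι) (q : ℝ) :
    Continuous (affineReflection μ u z q) := by
  unfold affineReflection; fun_prop

open Matrix in
/-- The reflection along `z = S u`, oblique with respect to `S`, preserves the Gaussian law with
covariance `S`. -/
lemma map_affineReflection_multivariateGaussian {ι : Type*} [Fintype ι] [DecidableEq ι]
    (μ u z : EuclideanSpace ℝ ι) {S : Matrix ι ι ℝ} (hS : S.PosSemidef)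
    (hz : z.ofLp = S *ᵥ u.ofLp) (hq : inner ℝ u z ≠ 0) :
    (multivariateGaussian μ S).map (affineReflection μ u z (inner ℝ u z)) =
      multivariateGaussian μ S := by
  have hm : Measurable (affineReflection μ u z (inner ℝ u z)) :=
    (continuous_affineReflection _ _ _ _).measurable
  have : IsProbabilityMeasure ((multivariateGaussian μ S).map
      (affineReflection μ u z (inner ℝ u z))) :=
    Measure.isProbabilityMeasure_map hm.aemeasurable
  apply Measure.ext_of_charFun
  ext t
  set q : ℝ := inner ℝ u z with hqdef
  set a : ℝ := inner ℝ z t with ha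
  have key : charFun ((multivariateGaussian μ S).map (affineReflection μ u z q)) t =
      Complex.exp (((2 * inner ℝ u μ * a / q : ℝ) : ℂ) * Complex.I) *
        charFun (multivariateGaussian μ S) (t - (2 * a / q) • u) := by
    rw [charFun_apply, integral_map hm.aemeasurable (by fun_prop), charFun_apply,
      ← integral_const_mul]
    congr 1 with x
    rw [← Complex.exp_add, ← add_mul, ← Complex.ofReal_add]
    congr 3
    simp only [affineReflection, inner_sub_left, inner_sub_right, inner_smul_left,
      inner_smul_right, ← ha]
    rw [real_inner_comm x u]
    simp
    ring
  have hdot (v : EuclideanSpace ℝ ι) : v.ofLp ⬝ᵥ S *ᵥ u.ofLp = inner ℝ z v := by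
    rw [← hz, EuclideanSpace.inner_eq_star_dotProduct]; simp
  have hdot' (v : EuclideanSpace ℝ ι) : u.ofLp ⬝ᵥ S *ᵥ v.ofLp = inner ℝ z v := by
    rw [← hdot, dotProduct_mulVec, ← mulVec_transpose, dotProduct_comm]
    congr 2
    exact hS.1
  have hzu : inner ℝ z u = q := by rw [hqdef, real_inner_comm]
  rw [key, charFun_multivariateGaussian hS, charFun_multivariateGaussian hS, ← Complex.exp_add]
  have hq' : u.ofLp ⬝ᵥ S *ᵥ u.ofLp = q := by rw [hdot, hzu]
  have hd' : u.ofLp ⬝ᵥ S *ᵥ t.ofLp = a := hdot' t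
  -- The adjoint of the reflection preserves the quadratic form of `S`, since `S u = z` and `u ⬝ᵥ S
  -- u = q`.
  have e1 : (t - (2 * a / q) • u).ofLp ⬝ᵥ S *ᵥ (t - (2 * a / q) • u).ofLp =
      t.ofLp ⬝ᵥ S *ᵥ t.ofLp := by
    simp only [WithLp.ofLp_sub, WithLp.ofLp_smul, mulVec_sub, mulVec_smul, dotProduct_sub,
      sub_dotProduct, dotProduct_smul, smul_dotProduct, hdot t, hq', hd', smul_eq_mul, ← ha]
    field_simp
    ring
  rw [e1, inner_sub_left, inner_smul_left]
  congr 1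
  push_cast
  simp
  ring

open Matrix in
/-- A Gaussian linear functional with nonzero variance is not almost surely constant. -/
lemma lintegral_enorm_inner_multivariateGaussian_pos {ι : Type*} [Fintype ι] [DecidableEq ι]
    (μ u : EuclideanSpace ℝ ι) {S : Matrix ι ι ℝ} (hS : S.PosSemidef)
    (hq : u.ofLp ⬝ᵥ S *ᵥ u.ofLp ≠ 0) :
    ∫⁻ x, ‖(inner ℝ u (x - μ) : ℝ)‖ₑ ^ 2 ∂(multivariateGaussian μ S) ≠ 0 := by
  intro h
  rw [lintegral_eq_zero_iff (by fun_prop)] at h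
  have hc := covarianceBilin_multivariateGaussian (μ := μ) hS u u
  rw [covarianceBilin_self IsGaussian.memLp_two_id] at hc
  apply hq
  rw [← hc, variance_congr (Y := fun _ => inner ℝ u μ)]
  · simp [variance_eq_integral aemeasurable_const]
  · filter_upwards [h] with x hx
    simpa [inner_sub_right, sub_eq_zero] using hx

/-- Applied with `a + b` and `a - b` the errors at a point and at its reflection, so that `b` is
half the displacement of `x₁`. -/
lemma two_mul_enorm_sq_le {E : Type*} [NormedAddCommGroup E] [InnerProductSpace ℝ E] (a b : E) :
    2 * ‖b‖ₑ ^ 2 ≤ ‖a + b‖ₑ ^ 2 + ‖a - b‖ₑ ^ 2 := by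
  have h := parallelogram_law_with_norm ℝ a b
  have h' : 2 * ‖b‖ ^ 2 ≤ ‖a + b‖ ^ 2 + ‖a - b‖ ^ 2 := by nlinarith [mul_self_nonneg ‖a‖]
  simp only [← ofReal_norm, ← ENNReal.ofReal_pow (norm_nonneg _)]
  rw [← ENNReal.ofReal_add (by positivity) (by positivity), ← ENNReal.ofReal_ofNat,
    ← ENNReal.ofReal_mul (by norm_num)]
  exact ENNReal.ofReal_le_ofReal h'

end GMMSideInfo

/-! ### Generic ranks and dimension counting -/

namespace GMMSideInfo

open Matrix Module
open scoped MatrixOrder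

/-- The matrices `A` with `P A B` singular form a null set, whenever `P A₀ B = 1` for some `A₀`. -/
lemma ae_det_mul_mul_ne_zero {m n k : ℕ} (P : Matrix (Fin k) (Fin m) ℝ)
    (B : Matrix (Fin n) (Fin k) ℝ) (A₀ : Matrix (Fin m) (Fin n) ℝ) (h : P * A₀ * B = 1) :
    ∀ᵐ A : Fin m → Fin n → ℝ, (P * of A * B).det ≠ 0 := by
  have hcont : Continuous fun A : Fin m → Fin n → ℝ => (P * of A * B).det := by
    apply Continuous.matrix_det
    apply Continuous.matrix_mul _ continuous_const
    exact Continuous.matrix_mul continuous_const continuous_id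
  -- Slice along lines `A + t A₀`: there the determinant is `det (t + P A B)`, a monic
  -- characteristic polynomial in `t` with finitely many roots.
  let L : ℝ →ₗ[ℝ] (Fin m → Fin n → ℝ) := LinearMap.toSpanSingleton ℝ _ (of.symm A₀)
  refine ae_mem_of_ae_add_linearMap_mem L volume volume
    (s := {A | (P * of A * B).det ≠ 0}) (hcont.measurable (measurableSet_singleton 0).compl) ?_
  intro A
  set p := (-(P * of A * B)).charpoly with hp
  have hfin : {t : ℝ | p.IsRoot t}.Finite :=
    Polynomial.finite_setOfPred_isRoot (charpoly_monic _).ne_zero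
  have h0 : ∀ᵐ t : ℝ, t ∉ {t : ℝ | p.IsRoot t} := by
    rw [ae_iff]
    simpa using hfin.measure_zero volume
  filter_upwards [h0] with t ht
  simp only [Polynomial.IsRoot] at ht ⊢
  rw [hp, eval_charpoly] at ht
  convert ht using 2
  have e : of (A + L t) = of A + t • A₀ := by
    ext i j; simp [L]
  rw [e, Matrix.mul_add, Matrix.add_mul, Matrix.mul_smul, Matrix.smul_mul, h, sub_neg_eq_add,
    add_comm]
  congr 1
  ext i j
  simp [Matrix.scalar_apply, Matrix.one_apply, Matrix.diagonal_apply]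

/-- Almost every matrix has the largest possible rank on a given subspace. -/
lemma ae_min_le_finrank_map {m n : ℕ} (N : Submodule ℝ (Fin n → ℝ)) :
    ∀ᵐ A : Fin m → Fin n → ℝ, min m (finrank ℝ N) ≤ finrank ℝ (N.map (of A).mulVecLin) := by
  set k := min m (finrank ℝ N) with hk
  have hkm : k ≤ m := min_le_left _ _
  have hkN : k ≤ finrank ℝ N := min_le_right _ _
  let b := finBasis ℝ N
  let v : Fin k → (Fin n → ℝ) := fun j => (b (Fin.castLE hkN j) : Fin n → ℝ)
  have hv : LinearIndependent ℝ v :=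
    ((b.linearIndependent.map' N.subtype N.ker_subtype).comp _ (Fin.castLE_injective hkN))
  let B : Matrix (Fin n) (Fin k) ℝ := (of v)ᵀ
  obtain ⟨C, hC⟩ : ∃ C : Matrix (Fin k) (Fin n) ℝ, C * B = 1 := by
    have hB : Function.Injective (toLin' B) := Matrix.mulVec_injective_iff.2 hv
    obtain ⟨g, hg⟩ := LinearMap.exists_leftInverse_of_injective _ (LinearMap.ker_eq_bot.2 hB)
    refine ⟨LinearMap.toMatrix' g, ?_⟩
    rw [← LinearMap.toMatrix'_toLin' B, ← LinearMap.toMatrix'_comp, hg, LinearMap.toMatrix'_id]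
  let J : Matrix (Fin m) (Fin k) ℝ := (1 : Matrix (Fin m) (Fin m) ℝ).submatrix id (Fin.castLE hkm)
  have hJ : Jᵀ * J = 1 := by
    ext i j
    simp [J, Matrix.mul_apply, Matrix.one_apply]
  filter_upwards [ae_det_mul_mul_ne_zero Jᵀ B (J * C)
    (by rw [← Matrix.mul_assoc, hJ, Matrix.one_mul, hC])] with A hA
  have hrank : (Jᵀ * of A * B).rank = k := by
    rw [Matrix.rank_of_isUnit _ ((Matrix.isUnit_iff_isUnit_det _).2 hA.isUnit), Fintype.card_fin]
  calc k = (Jᵀ * of A * B).rank := hrank.symm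
    _ ≤ (of A * B).rank := by rw [Matrix.mul_assoc]; exact Matrix.rank_mul_le_right _ _
    _ ≤ finrank ℝ (N.map (of A).mulVecLin) := by
      apply Submodule.finrank_mono
      rintro _ ⟨x, rfl⟩
      refine ⟨B *ᵥ x, ?_, by simp⟩
      rw [Matrix.mulVec_eq_sum]
      exact N.sum_mem fun j _ => by
        rw [op_smul_eq_smul]
        exact N.smul_mem _ (b (Fin.castLE hkN j)).2

/-- If two linear features determine one component of a vector of `V` up to the kernel, then the
numbers of features are bounded below in terms of the ranks of the components. -/
lemma finrank_bounds_of_features {V E₁ E₂ F₁ F₂ : Type*} [AddCommGroup V] [Module ℝ V]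
    [FiniteDimensional ℝ V] [AddCommGroup E₁] [Module ℝ E₁] [AddCommGroup E₂] [Module ℝ E₂]
    [AddCommGroup F₁] [Module ℝ F₁] [FiniteDimensional ℝ F₁]
    [AddCommGroup F₂] [Module ℝ F₂] [FiniteDimensional ℝ F₂]
    (a₁ : V →ₗ[ℝ] E₁) (a₂ : V →ₗ[ℝ] E₂) (φ₁ : E₁ →ₗ[ℝ] F₁) (φ₂ : E₂ →ₗ[ℝ] F₂)
    (hinj : ∀ z, a₁ z = 0 → a₂ z = 0 → z = 0)
    (hdet : ∀ z, φ₁ (a₁ z) = 0 → φ₂ (a₂ z) = 0 → a₁ z = 0)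
    (hgen : min (finrank ℝ F₂) (finrank ℝ ((LinearMap.ker a₁).map a₂)) ≤
      finrank ℝ (((LinearMap.ker a₁).map a₂).map φ₂)) :
    finrank ℝ V ≤ finrank ℝ F₁ + finrank ℝ (LinearMap.range a₂) ∧
      (finrank ℝ (LinearMap.range a₁) ≤ finrank ℝ F₁ ∨
        finrank ℝ V ≤ finrank ℝ F₁ + finrank ℝ F₂) := by
  constructor
  · have h1 : finrank ℝ (LinearMap.ker a₂) ≤ finrank ℝ F₁ := by
      apply LinearMap.finrank_le_finrank_of_injective
        (f := (φ₁ ∘ₗ a₁) ∘ₗ (LinearMap.ker a₂).subtype)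
      rw [← LinearMap.ker_eq_bot, LinearMap.ker_eq_bot']
      rintro ⟨z, hz⟩ h
      have hz' : a₂ z = 0 := hz
      have : z = 0 := hinj z (hdet z h (by rw [hz', map_zero])) hz'
      exact Subtype.ext this
    have := a₂.finrank_range_add_finrank_ker
    omega
  · let g := φ₂ ∘ₗ a₂ ∘ₗ (LinearMap.ker a₁).subtype
    have hW : finrank ℝ V ≤ finrank ℝ F₁ + finrank ℝ F₂ + finrank ℝ (LinearMap.ker g) := by
      let Ψ := (φ₁ ∘ₗ a₁).prod (φ₂ ∘ₗ a₂)
      have h1 := Ψ.finrank_range_add_finrank_ker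
      have h2 : finrank ℝ (LinearMap.range Ψ) ≤ finrank ℝ F₁ + finrank ℝ F₂ := by
        rw [← finrank_prod]; exact Submodule.finrank_le _
      -- By `hdet`, vectors invisible to both features lie in `ker a₁`.
      have h3 : finrank ℝ (LinearMap.ker Ψ) ≤ finrank ℝ (LinearMap.ker g) := by
        have hz : ∀ z ∈ LinearMap.ker Ψ, φ₁ (a₁ z) = 0 ∧ φ₂ (a₂ z) = 0 := by
          intro z hz; simpa [Ψ] using hz
        let f : LinearMap.ker Ψ →ₗ[ℝ] LinearMap.ker g :=
          ((LinearMap.ker Ψ).subtype.codRestrict (LinearMap.ker a₁)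
            (fun z => hdet z (hz z z.2).1 (hz z z.2).2)).codRestrict _ (fun z => (hz z z.2).2)
        apply LinearMap.finrank_le_finrank_of_injective (f := f)
        intro x y hxy
        have := congrArg (fun t : LinearMap.ker g => ((t : LinearMap.ker a₁) : V)) hxy
        exact Subtype.ext this
      omega
    have hN : finrank ℝ ((LinearMap.ker a₁).map a₂) = finrank ℝ (LinearMap.ker a₁) := by
      have hi : Function.Injective (a₂ ∘ₗ (LinearMap.ker a₁).subtype) := by
        rw [← LinearMap.ker_eq_bot, LinearMap.ker_eq_bot']
        rintro ⟨z, hz⟩ h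
        exact Subtype.ext (hinj z hz h)
      rw [← LinearMap.finrank_range_of_inj hi, LinearMap.range_comp, Submodule.range_subtype]
    have hg : finrank ℝ (LinearMap.range g) =
        finrank ℝ (((LinearMap.ker a₁).map a₂).map φ₂) := by
      rw [LinearMap.range_comp, LinearMap.range_comp, Submodule.range_subtype]
    have h4 := g.finrank_range_add_finrank_ker
    have h5 := a₁.finrank_range_add_finrank_ker
    -- If the minimum is `dim (ker a₁)`, then `g` is injective and `dim V ≤ dim F₁ + dim F₂`; if it
    -- is `dim F₂`, rank-nullity for `g` and `a₁` turns `hW` into `rank a₁ ≤ dim F₁`.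
    rw [hN, ← hg] at hgen
    omega

/-- For a positive semidefinite `S`, the rank of a compression `T S Tᴴ` is that of `T S`. -/
lemma rank_mul_mul_conjTranspose_eq {ι κ : Type*} [Fintype ι] [Fintype κ] [DecidableEq ι]
    {S : Matrix ι ι ℝ} (hS : S.PosSemidef) (T : Matrix κ ι ℝ) :
    (T * S * Tᴴ).rank = (T * S).rank := by
  apply le_antisymm (Matrix.rank_mul_le_left _ _)
  obtain ⟨R, rfl⟩ := CStarAlgebra.nonneg_iff_eq_star_mul_self.mp hS.nonneg
  rw [star_eq_conjTranspose]
  calc (T * (Rᴴ * R)).rank ≤ (T * Rᴴ).rank := by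
        rw [← Matrix.mul_assoc]; exact Matrix.rank_mul_le_left _ _
    _ = ((T * Rᴴ) * (T * Rᴴ)ᴴ).rank := (Matrix.rank_self_mul_conjTranspose _).symm
    _ = (T * (Rᴴ * R) * Tᴴ).rank := by simp [Matrix.mul_assoc]

/-- For a positive semidefinite `S`, the rank of a principal submatrix is the dimension of the
coordinate projection of the range of `S`. -/
lemma finrank_range_funLeft_domRestrict {ι κ : Type*} [Fintype ι] [Fintype κ] [DecidableEq ι]
    {S : Matrix ι ι ℝ} (hS : S.PosSemidef) (e : κ → ι) :
    finrank ℝ (LinearMap.range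
      ((LinearMap.funLeft ℝ ℝ e).domRestrict (LinearMap.range S.mulVecLin))) =
      (S.submatrix e e).rank := by
  have h := rank_mul_mul_conjTranspose_eq hS ((1 : Matrix ι ι ℝ).submatrix e id)
  have h1 : (1 : Matrix ι ι ℝ).submatrix e id * S = S.submatrix e id := by
    ext i j; simp [Matrix.mul_apply, Matrix.one_apply]
  have h2 : S.submatrix e id * ((1 : Matrix ι ι ℝ).submatrix e id)ᴴ = S.submatrix e e := by
    ext i j; simp [Matrix.mul_apply, Matrix.one_apply]
  rw [h1, h2] at h
  rw [h, Matrix.rank, LinearMap.range_domRestrict, ← LinearMap.range_comp]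
  rfl

end GMMSideInfo

/-! ### Noise-independent lower bound on the MMSE -/

namespace GMMSideInfo

open Matrix Module

instance (m : ℕ) (v : ℝ) : IsProbabilityMeasure (noiseLaw m v) := by
  unfold noiseLaw; infer_instance

variable {K₁ K₂ n₁ n₂ m₁ m₂ : ℕ}

instance (M : JointGMM K₁ K₂ n₁ n₂) : IsFiniteMeasure M.law := by
  have (c : Fin K₁ × Fin K₂) : IsFiniteMeasure
      (M.pmf c • (Measure.dirac c).prod (multivariateGaussian (M.mean c.1 c.2) (M.cov c.1 c.2))) :=
    Measure.smul_finite _ (M.pmf.apply_ne_top c)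
  unfold JointGMM.law
  infer_instance

lemma measurable_signal₁ : Measurable (signal₁ : Sample K₁ K₂ n₁ n₂ m₁ m₂ → _) := by
  unfold signal₁; fun_prop

lemma measurable_features (Φ₁ : Matrix (Fin m₁) (Fin n₁) ℝ) (Φ₂ : Matrix (Fin m₂) (Fin n₂) ℝ) :
    Measurable (features Φ₁ Φ₂ : Sample K₁ K₂ n₁ n₂ m₁ m₂ → _) := by
  have h₁ := (toEuclideanLin Φ₁).continuous_of_finiteDimensional.measurable
  have h₂ := (toEuclideanLin Φ₂).continuous_of_finiteDimensional.measurable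
  have h₃ : Measurable (signal₂ : Sample K₁ K₂ n₁ n₂ m₁ m₂ → _) := by unfold signal₂; fun_prop
  exact ((h₁.comp measurable_signal₁).add (by fun_prop)).prodMk
    ((h₂.comp h₃).add (by fun_prop))

/-- The contribution of one class to an integral against the model law. -/
lemma pmf_mul_lintegral_le_lintegral_modelLaw (M : JointGMM K₁ K₂ n₁ n₂) (v : ℝ)
    (c : Fin K₁ × Fin K₂) {F : Sample K₁ K₂ n₁ n₂ m₁ m₂ → ℝ≥0∞} (hF : Measurable F) :
    M.pmf c * ∫⁻ x, ∫⁻ w, F ((c, x), w) ∂((noiseLaw m₁ v).prod (noiseLaw m₂ v))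
        ∂(multivariateGaussian (M.mean c.1 c.2) (M.cov c.1 c.2)) ≤
      ∫⁻ s, F s ∂(modelLaw M m₁ m₂ v) := by
  rw [modelLaw, lintegral_prod _ hF.aemeasurable, JointGMM.law, lintegral_finsetSum_measure]
  refine le_trans (le_of_eq ?_) (Finset.single_le_sum (fun _ _ => zero_le) (Finset.mem_univ c))
  rw [lintegral_smul_measure, Measure.dirac_prod,
    lintegral_map hF.lintegral_prod_right' measurable_prodMk_left, smul_eq_mul]

/-- If `z = S u` is invisible to the features, where `S` is the covariance of a class, then the
MMSE is bounded below, uniformly in the noise variance, in terms of the first component of `z`. -/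
lemma le_mmseGMM_of_feature_eq_zero (M : JointGMM K₁ K₂ n₁ n₂) (Φ₁ : Matrix (Fin m₁) (Fin n₁) ℝ)
    (Φ₂ : Matrix (Fin m₂) (Fin n₂) ℝ) (i : Fin K₁) (k : Fin K₂)
    (u z : EuclideanSpace ℝ (Fin n₁ ⊕ Fin n₂)) (hz : z.ofLp = M.cov i k *ᵥ u.ofLp)
    (hq : inner ℝ u z ≠ 0)
    (h₁ : Φ₁ *ᵥ (fun a => z (Sum.inl a)) = 0) (h₂ : Φ₂ *ᵥ (fun b => z (Sum.inr b)) = 0) (v : ℝ) :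
    M.pmf (i, k) * (‖(inner ℝ u z : ℝ)⁻¹ • WithLp.toLp 2 (fun a => z (Sum.inl a))‖ₑ ^ 2 *
      ∫⁻ x, ‖(inner ℝ u (x - M.mean i k) : ℝ)‖ₑ ^ 2
        ∂(multivariateGaussian (M.mean i k) (M.cov i k))) ≤ mmseGMM M Φ₁ Φ₂ v := by
  set q : ℝ := inner ℝ u z with hqd
  set z₁ : EuclideanSpace ℝ (Fin n₁) := WithLp.toLp 2 (fun a => z (Sum.inl a)) with hz₁
  set f := (modelLaw M m₁ m₂ v)[signal₁ | MeasurableSpace.comap (features Φ₁ Φ₂) inferInstance]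
    with hf
  have hsm : StronglyMeasurable[MeasurableSpace.comap (features Φ₁ Φ₂) inferInstance] f :=
    stronglyMeasurable_condExp
  -- This holds pointwise, not just almost everywhere, so `f` agrees at a sample and its reflection.
  have hfac : f.FactorsThrough (features Φ₁ Φ₂) := hsm.factorsThrough
  have hfm : Measurable f := (hsm.mono (measurable_features Φ₁ Φ₂).comap_le).measurable
  have hF : Measurable fun s => ‖signal₁ s - f s‖ₑ ^ 2 :=
    ((measurable_signal₁.sub hfm).enorm).pow_const 2
  refine le_trans ?_ (pmf_mul_lintegral_le_lintegral_modelLaw M v (i, k) hF)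
  gcongr
  set G := multivariateGaussian (M.mean i k) (M.cov i k) with hG
  set N := (noiseLaw m₁ v).prod (noiseLaw m₂ v) with hN
  set R := affineReflection (M.mean i k) u z q with hR
  have hRm : Measurable R := (continuous_affineReflection _ _ _ _).measurable
  set H := fun x => ∫⁻ w, ‖signal₁ ((((i, k), x), w) : Sample K₁ K₂ n₁ n₂ m₁ m₂) -
    f (((i, k), x), w)‖ₑ ^ 2 ∂N with hH
  have hHm : Measurable H := hF.lintegral_prod_right'.comp measurable_prodMk_left
  have hHR : ∫⁻ x, H (R x) ∂G = ∫⁻ x, H x ∂G := by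
    rw [← lintegral_map hHm hRm, hR, hG,
      map_affineReflection_multivariateGaussian _ _ _ (M.cov_posSemidef i k) hz hq]
  have hsig (x) (w) : signal₁ ((((i, k), R x), w) : Sample K₁ K₂ n₁ n₂ m₁ m₂) =
      signal₁ ((((i, k), x), w) : Sample K₁ K₂ n₁ n₂ m₁ m₂) -
        (2 * inner ℝ u (x - M.mean i k) / q) • z₁ := by
    ext a; simp [signal₁, hR, affineReflection, hz₁]
  have hfeat (x) (w) : features Φ₁ Φ₂ ((((i, k), R x), w) : Sample K₁ K₂ n₁ n₂ m₁ m₂) =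
      features Φ₁ Φ₂ (((i, k), x), w) := by
    have hs₂ : signal₂ ((((i, k), R x), w) : Sample K₁ K₂ n₁ n₂ m₁ m₂) =
      signal₂ ((((i, k), x), w) : Sample K₁ K₂ n₁ n₂ m₁ m₂) -
        (2 * inner ℝ u (x - M.mean i k) / q) • WithLp.toLp 2 (fun b => z (Sum.inr b)) := by
      ext a; simp [signal₂, hR, affineReflection]
    simp only [features, hsig, hs₂, map_sub, map_smul, hz₁, toLpLin_toLp]
    simp [h₁, h₂]
  have hpt (x) : 2 * (‖q⁻¹ • z₁‖ₑ ^ 2 * ‖(inner ℝ u (x - M.mean i k) : ℝ)‖ₑ ^ 2) ≤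
      H x + H (R x) := by
    have hadd : H x + H (R x) = ∫⁻ w, (‖signal₁ ((((i, k), x), w) : Sample K₁ K₂ n₁ n₂ m₁ m₂) -
        f (((i, k), x), w)‖ₑ ^ 2 + ‖signal₁ ((((i, k), R x), w) : Sample K₁ K₂ n₁ n₂ m₁ m₂) -
        f (((i, k), R x), w)‖ₑ ^ 2) ∂N :=
      (lintegral_add_left (hF.comp measurable_prodMk_left) _).symm
    rw [hadd]
    refine le_trans (le_of_eq ?_) (lintegral_mono (f := fun _ => 2 * ‖((inner ℝ u
      (x - M.mean i k) : ℝ) / q) • z₁‖ₑ ^ 2) fun w => ?_)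
    · rw [lintegral_const, measure_univ, mul_one, ← mul_pow, div_eq_mul_inv, mul_smul,
        enorm_smul (inner ℝ u (x - M.mean i k) : ℝ), mul_comm ‖(inner ℝ u _ : ℝ)‖ₑ]
    · rw [hfac (hfeat x w), hsig]
      refine (two_mul_enorm_sq_le (signal₁ ((((i, k), x), w) : Sample K₁ K₂ n₁ n₂ m₁ m₂) -
        f (((i, k), x), w) - ((inner ℝ u (x - M.mean i k) : ℝ) / q) • z₁) _).trans
        (le_of_eq ?_)
      congr 3
      · abel
      · rw [mul_div_assoc, mul_smul, two_smul]; abel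
  have h2 : 2 * (‖q⁻¹ • z₁‖ₑ ^ 2 * ∫⁻ x, ‖(inner ℝ u (x - M.mean i k) : ℝ)‖ₑ ^ 2 ∂G) ≤
      2 * ∫⁻ x, H x ∂G := by
    calc _ = ∫⁻ x, 2 * (‖q⁻¹ • z₁‖ₑ ^ 2 * ‖(inner ℝ u (x - M.mean i k) : ℝ)‖ₑ ^ 2) ∂G := by
          rw [lintegral_const_mul _ (by fun_prop), lintegral_const_mul _ (by fun_prop)]
      _ ≤ ∫⁻ x, (H x + H (R x)) ∂G := lintegral_mono hpt
      _ = 2 * ∫⁻ x, H x ∂G := by rw [lintegral_add_left hHm, hHR, two_mul]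
  exact (ENNReal.mul_le_mul_iff_right (by norm_num) (by norm_num)).1 h2

/-- If the MMSE vanishes in the low-noise limit, then in every class of positive probability, a
vector of the range of the covariance which is invisible to the features has zero first
component. -/
lemma eq_zero_of_tendsto_mmseGMM (M : JointGMM K₁ K₂ n₁ n₂) (Φ₁ : Matrix (Fin m₁) (Fin n₁) ℝ)
    (Φ₂ : Matrix (Fin m₂) (Fin n₂) ℝ)
    (h : Tendsto (fun v : ℝ => mmseGMM M Φ₁ Φ₂ v) (𝓝[>] 0) (𝓝 0))
    {i : Fin K₁} {k : Fin K₂} (hp : 0 < M.pmf (i, k)) {z : Fin n₁ ⊕ Fin n₂ → ℝ}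
    (hz : z ∈ LinearMap.range (M.cov i k).mulVecLin)
    (h₁ : Φ₁ *ᵥ (fun a => z (Sum.inl a)) = 0) (h₂ : Φ₂ *ᵥ (fun b => z (Sum.inr b)) = 0) :
    (fun a => z (Sum.inl a)) = 0 := by
  obtain ⟨u, rfl⟩ := hz
  by_contra hne
  -- For a positive semidefinite matrix, `u ⬝ᵥ S u = 0` forces `S u = 0`.
  have hq : u ⬝ᵥ M.cov i k *ᵥ u ≠ 0 := by
    intro h0
    have := ((M.cov_posSemidef i k).dotProduct_mulVec_zero_iff u).1 (by simpa using h0)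
    exact hne (by ext a; simp [this])
  have hq' : inner ℝ (WithLp.toLp 2 u) (WithLp.toLp 2 (M.cov i k *ᵥ u)) ≠ (0 : ℝ) := by
    rw [EuclideanSpace.inner_eq_star_dotProduct]
    simpa [dotProduct_comm] using hq
  have hle := ge_of_tendsto' h fun v => le_mmseGMM_of_feature_eq_zero M Φ₁ Φ₂ i k
    (WithLp.toLp 2 u) (WithLp.toLp 2 (M.cov i k *ᵥ u)) rfl hq' h₁ h₂ v
  have hpos := lintegral_enorm_inner_multivariateGaussian_pos (M.mean i k) (WithLp.toLp 2 u)
    (M.cov_posSemidef i k) hq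
  rw [le_zero_iff, mul_eq_zero, mul_eq_zero, or_iff_right hp.ne', or_iff_left hpos,
    pow_eq_zero_iff two_ne_zero, enorm_eq_zero, smul_eq_zero, or_iff_right (inv_ne_zero hq')] at hle
  exact hne (by simpa using congrArg WithLp.ofLp hle)

/-- Almost surely, an admissible random kernel has the largest possible rank on a subspace. -/
lemma ae_min_le_finrank_map_kernel {Ω : Type*} [MeasurableSpace Ω] {P : Measure Ω} {m n : ℕ}
    {Φ : Ω → Matrix (Fin m) (Fin n) ℝ}
    (hΦ : IsLeftRotationInvariant P Φ ∨ IsIdentityKernel P Φ) (N : Submodule ℝ (Fin n → ℝ)) :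
    ∀ᵐ ω ∂P, min m (finrank ℝ N) ≤ finrank ℝ (N.map (Φ ω).mulVecLin) := by
  rcases hΦ with ⟨hm, p, -, hp, -⟩ | ⟨rfl, hid⟩
  · refine ae_of_ae_map hm (p := fun A => min m (finrank ℝ N) ≤
      finrank ℝ (N.map (of A).mulVecLin)) ?_
    rw [hp]
    exact (withDensity_absolutelyContinuous _ _).ae_le (ae_min_le_finrank_map N)
  · filter_upwards [hid] with ω hω
    have h1 : Φ ω = 1 := by rw [hω]; rfl
    rw [h1, Matrix.mulVecLin_one, Submodule.map_id]
    exact min_le_right _ _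

end GMMSideInfo

theorem theorem5 {K₁ K₂ n₁ n₂ m₁ m₂ : ℕ} (M : GMMSideInfo.JointGMM K₁ K₂ n₁ n₂)
    {Ω : Type*} [MeasurableSpace Ω] (P : Measure Ω) [IsProbabilityMeasure P]
    (Φ₁ : Ω → Matrix (Fin m₁) (Fin n₁) ℝ) (Φ₂ : Ω → Matrix (Fin m₂) (Fin n₂) ℝ)
    (hΦ₁ : GMMSideInfo.IsLeftRotationInvariant P Φ₁)
    (hΦ₂ : GMMSideInfo.IsLeftRotationInvariant P Φ₂ ∨ GMMSideInfo.IsIdentityKernel P Φ₂) :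
    ∀ᵐ ω ∂P,
      Tendsto (fun v : ℝ => GMMSideInfo.mmseGMM M (Φ₁ ω) (Φ₂ ω) v) (𝓝[>] 0) (𝓝 0) →
        ∀ (i : Fin K₁) (k : Fin K₂), 0 < M.pmf (i, k) →
          (M.rankX₁ i k ≤ m₁ ∨
            ((M.rankX i k : ℤ) - (M.rankX₂ i k : ℤ) ≤ (m₁ : ℤ) ∧ M.rankX i k ≤ m₁ + m₂)) := by
  -- These subspaces depend on the class alone, not on `ω`, so one null set serves all the finitely
  -- many classes.
  have hgen : ∀ᵐ ω ∂P, ∀ i k, _ := ae_all_iff.2 fun i => ae_all_iff.2 fun k =>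
    GMMSideInfo.ae_min_le_finrank_map_kernel hΦ₂
      ((LinearMap.ker ((LinearMap.funLeft ℝ ℝ Sum.inl).domRestrict
        (LinearMap.range (M.cov i k).mulVecLin))).map
        ((LinearMap.funLeft ℝ ℝ Sum.inr).domRestrict (LinearMap.range (M.cov i k).mulVecLin)))
  filter_upwards [hgen] with ω hω hlim i k hp
  have h := GMMSideInfo.finrank_bounds_of_features
    ((LinearMap.funLeft ℝ ℝ Sum.inl).domRestrict (LinearMap.range (M.cov i k).mulVecLin))
    ((LinearMap.funLeft ℝ ℝ Sum.inr).domRestrict (LinearMap.range (M.cov i k).mulVecLin))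
    (Φ₁ ω).mulVecLin (Φ₂ ω).mulVecLin
    (by
      rintro ⟨z, hz⟩ h₁ h₂
      ext a
      rcases a with a | b
      · exact congrFun h₁ a
      · exact congrFun h₂ b)
    (by
      rintro ⟨z, hz⟩ h₁ h₂
      exact GMMSideInfo.eq_zero_of_tendsto_mmseGMM M (Φ₁ ω) (Φ₂ ω) hlim hp hz h₁ h₂)
    (by simpa only [Module.finrank_fin_fun] using hω i k)
  rw [GMMSideInfo.finrank_range_funLeft_domRestrict (M.cov_posSemidef i k),
    GMMSideInfo.finrank_range_funLeft_domRestrict (M.cov_posSemidef i k),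
    Module.finrank_fin_fun, Module.finrank_fin_fun] at h
  change M.rankX i k ≤ m₁ + M.rankX₂ i k ∧
    (M.rankX₁ i k ≤ m₁ ∨ M.rankX i k ≤ m₁ + m₂) at h
  omega
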